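/- Let $\pi=(p_1,p_2,\ldots)$ be an infinite sequence of primes. For a group $G$ define $\gamma_0^\pi(G)=G$ and $$\gamma_i^\pi(G)=[\gamma_{i-1}^\pi(G),\gamma_{i-1}^\pi(G)]\,\bigl(\gamma_{i-1}^\pi(G)\bigr)^{p_i}\qquad(i\ge 1),$$ where $H^{q}$ denotes the subgroup generated by the $q$-th powers of the elements of $H$. For $x\in G$ let $\langle\langle x\rangle\rangle^G$ denote the normal closure of $x$ in $G$. Let $G$ be a finitely generated group, and suppose that for some $r\ge 0$ the group $\gamma_r^\pi(G)$ admits an epimorphism onto a non-abelian free group. Then for every $g\in\gamma_r^\pi(G)$ there is $m\ge r$ such that for every integer $n\ge 0$ with $g^n\in\gamma_m^\pi(G)$, the quotient $\gamma_m^\pi(G)/\langle\langle g^n\rangle\rangle^G$ admits an epimorphism onto a non-abelian free group. -/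

import Mathlib

/-- The series `γ_0 = G`, `γ_{i+1} = [γ_i, γ_i] (γ_i)^{q_{i+1}}`. The sequence is stored from
index `0`, so the term `q_{i+1}` of the sequence `(q_1, q_2, …)` is `q i`. The product of the
normal subgroups `[γ_i, γ_i]` and `(γ_i)^q` (generated by the `q`-th powers) is their join. -/
def gammaSeries (G : Type*) [Group G] (q : ℕ → ℕ) : ℕ → Subgroup G
  | 0 => ⊤
  | i + 1 =>
      ⁅gammaSeries G q i, gammaSeries G q i⁆ ⊔
        Subgroup.closure {y : G | ∃ x ∈ gammaSeries G q i, y = x ^ q i}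

/-- `H` admits an epimorphism onto some non-abelian free group. (A free quotient of `H` has a
basis no larger than `H`, so bases in the universe of `H` suffice.) -/
def MapsOntoNonabelianFree.{u} (H : Type u) [Group H] : Prop :=
  ∃ α : Type u, (∃ a b : FreeGroup α, a * b ≠ b * a) ∧
    ∃ f : H →* FreeGroup α, Function.Surjective f

/-!
Let `N = γ_r(G)` and let `φ : N → F` be an epimorphism onto a nonabelian free group. Since `G` is
finitely generated, all terms of the series have finite index, and `φ` maps `γ_{r+j}(G)` onto the
`j`-th term of the series of `F` for the shifted sequence of primes. The subgroup `N` is normal, so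
up to conjugation in `N` there are only finitely many conjugates of `g` in `G`; let `E ⊆ F` be the
set of their images. It suffices to find `j` and a homomorphism with nonabelian image from
`K_j = γ_j(F)` to a free group that kills all conjugates of powers `f ^ n ∈ K_j`, `f ∈ E`
(`exists_hom_gammaSeries_freeGroup`); the image is free by the Nielsen-Schreier theorem.

The terms `K_j` intersect trivially: a shortest nontrivial word in a normal subgroup `H` runs
through a simple cycle in the Cayley graph of `F ⧸ H`, hence is nontrivial in the homology of the
graph modulo `p` and does not lie in `[H, H] H ^ p` (`exists_norm_lt_of_mem_verbalStep`). Free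
groups being torsion-free, the order of each `f ≠ 1` modulo `K = K_j` is as large as desired. If it
is `o`, then the conjugates of powers of `f` in `K` lie in the normal closure in `K` of
`[F : K] / o` conjugates of `f ^ o`, independently of the exponents `n`. As the rank of `K` is at
least `[F : K]` (`index_le_card_of_equiv`), imposing these relators on `K` gives a group `Q` with
at least two more generators than relators.

The construction of Baumslag and Pride now applies (`exists_hom_of_card_add_two_le`). A linear
system over `ℤ` with more unknowns than equations gives a nonzero `τ : Q → ℤ`, and one over
`ℤ[T;T⁻¹]` gives a crossed homomorphism `c` into `ℤ[T;T⁻¹]` which does not vanish on the kernel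
of `τ`, that is, a homomorphism from `Q` to `ℤ ≀ ℤ`. Lifted to the free group `K`, the latter is
a limit of homomorphisms to the wreath product of the free group on `y, z` with `ℤ`, in which `z`
carries the coefficients of `c` and `y` carries `τ`, and whose components are `n`-periodic up to
conjugation by `y` (`wreathHom`); for large `n` they kill the finitely many relators. A component of
such a homomorphism, corrected by a power of `y`, maps the preimage of `n ℤ` under `τ` to
the free group, with nonabelian image. When `n` is the product of sufficiently many consecutive
primes of the sequence, this preimage contains a later term of the series.

All the linear algebra rests on crossed homomorphisms on free groups, which are given by arbitrary
values at the generators (`crossedHom`).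
-/

/-! ### The verbal series -/

/-- The subgroup `[H, H] H ^ q`, by which `gammaSeries` passes from one term to the next. -/
def verbalStep {G : Type*} [Group G] (H : Subgroup G) (q : ℕ) : Subgroup G :=
  ⁅H, H⁆ ⊔ Subgroup.closure {y : G | ∃ x ∈ H, y = x ^ q}

section Series

open scoped commutatorElement

variable {G : Type*} [Group G]

theorem gammaSeries_succ (q : ℕ → ℕ) (i : ℕ) :
    gammaSeries G q (i + 1) = verbalStep (gammaSeries G q i) (q i) := rfl

theorem verbalStep_le_iff {H L : Subgroup G} {q : ℕ} :
    verbalStep H q ≤ L ↔ (∀ x ∈ H, ∀ y ∈ H, ⁅x, y⁆ ∈ L) ∧ ∀ x ∈ H, x ^ q ∈ L := by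
  rw [verbalStep, sup_le_iff, Subgroup.commutator_le, Subgroup.closure_le]
  refine and_congr Iff.rfl ⟨fun h x hx => h ⟨x, hx, rfl⟩, ?_⟩
  rintro h _ ⟨x, hx, rfl⟩
  exact h x hx

theorem verbalStep_le (H : Subgroup G) (q : ℕ) : verbalStep H q ≤ H :=
  verbalStep_le_iff.2 ⟨fun _ hx _ hy => H.mul_mem (H.mul_mem (H.mul_mem hx hy) (H.inv_mem hx))
    (H.inv_mem hy), fun _ hx => H.pow_mem hx _⟩

theorem commutator_mem_verbalStep {H : Subgroup G} (q : ℕ) {x y : G} (hx : x ∈ H) (hy : y ∈ H) :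
    ⁅x, y⁆ ∈ verbalStep H q :=
  (verbalStep_le_iff.1 le_rfl).1 x hx y hy

theorem pow_mem_verbalStep {H : Subgroup G} (q : ℕ) {x : G} (hx : x ∈ H) :
    x ^ q ∈ verbalStep H q :=
  (verbalStep_le_iff.1 le_rfl).2 x hx

theorem map_verbalStep {G' : Type*} [Group G'] (f : G →* G') (H : Subgroup G) (q : ℕ) :
    (verbalStep H q).map f = verbalStep (H.map f) q := by
  rw [verbalStep, verbalStep, Subgroup.map_sup, Subgroup.map_commutator, MonoidHom.map_closure]
  congr 2
  ext y
  constructor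
  · rintro ⟨_, ⟨x, hx, rfl⟩, rfl⟩
    exact ⟨f x, Subgroup.mem_map_of_mem f hx, map_pow f x q⟩
  · rintro ⟨_, ⟨x, hx, rfl⟩, rfl⟩
    exact ⟨x ^ q, ⟨x, hx, rfl⟩, map_pow f x q⟩

theorem map_gammaSeries_of_surjective {G' : Type*} [Group G'] (f : G →* G')
    (hf : Function.Surjective f) (q : ℕ → ℕ) (i : ℕ) :
    (gammaSeries G q i).map f = gammaSeries G' q i := by
  induction i with
  | zero => exact Subgroup.map_top_of_surjective f hf
  | succ i ih => rw [gammaSeries_succ, map_verbalStep, ih, gammaSeries_succ]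

theorem gammaSeries_antitone (q : ℕ → ℕ) : Antitone (gammaSeries G q) :=
  antitone_nat_of_succ_le fun _ => verbalStep_le _ _

instance gammaSeries_normal (q : ℕ → ℕ) (i : ℕ) : (gammaSeries G q i).Normal where
  conj_mem n hn g := by
    rw [← map_gammaSeries_of_surjective (MulAut.conj g).toMonoidHom (MulAut.conj g).surjective]
    exact Subgroup.mem_map_of_mem (MulAut.conj g).toMonoidHom hn

/-- The series of `γ_r`, for the sequence shifted by `r`, continues the series of the group. -/
theorem gammaSeries_add (q : ℕ → ℕ) (r j : ℕ) :
    gammaSeries G q (r + j) =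
      (gammaSeries (gammaSeries G q r) (fun i => q (r + i)) j).map
        (gammaSeries G q r).subtype := by
  induction j with
  | zero => simp [gammaSeries, ← MonoidHom.range_eq_map]
  | succ j ih => rw [← add_assoc, gammaSeries_succ, ih, gammaSeries_succ, map_verbalStep]

theorem verbalStep_finiteIndex [Group.FG G] {q : ℕ} (hq : 0 < q) :
    (verbalStep (⊤ : Subgroup G) q).FiniteIndex := by
  set V := verbalStep (⊤ : Subgroup G) q
  have hV : V.Normal := gammaSeries_normal (fun _ => q) 1
  -- the quotient is a finitely generated abelian group of exponent dividing `q`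
  let _ : CommGroup (G ⧸ V) :=
    { (inferInstance : Group (G ⧸ V)) with
      mul_comm := by
        intro a b
        obtain ⟨x, rfl⟩ := QuotientGroup.mk'_surjective V a
        obtain ⟨y, rfl⟩ := QuotientGroup.mk'_surjective V b
        have : QuotientGroup.mk' V ⁅x, y⁆ = 1 :=
          (QuotientGroup.eq_one_iff _).2 (commutator_mem_verbalStep q trivial trivial)
        rw [map_commutatorElement] at this
        exact commutatorElement_eq_one_iff_mul_comm.1 this }
  have hfg : Group.FG (G ⧸ V) := QuotientGroup.fg V
  have htor : IsMulTorsion (G ⧸ V) := by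
    intro a
    obtain ⟨x, rfl⟩ := QuotientGroup.mk'_surjective V a
    refine isOfFinOrder_iff_pow_eq_one.2 ⟨q, hq, ?_⟩
    rw [← map_pow]
    exact (QuotientGroup.eq_one_iff _).2 (pow_mem_verbalStep q trivial)
  have : Finite (G ⧸ V) := CommGroup.finite_of_fg_isMulTorsion (G ⧸ V) htor
  exact Subgroup.finiteIndex_of_finite_quotient

theorem gammaSeries_finiteIndex [hG : Group.FG G] {q : ℕ → ℕ} (hq : ∀ i, 0 < q i) (i : ℕ) :
    (gammaSeries G q i).FiniteIndex := by
  induction i with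
  | zero => exact inferInstanceAs (⊤ : Subgroup G).FiniteIndex
  | succ i ih =>
    have : Group.FG (gammaSeries G q i) := Subgroup.fg_of_index_ne_zero _
    have h := verbalStep_finiteIndex (G := gammaSeries G q i) (hq i)
    have h1 := gammaSeries_add (G := G) q i 1
    rw [h1]
    refine ⟨?_⟩
    rw [Subgroup.index_map_subtype]
    exact mul_ne_zero h.index_ne_zero ih.index_ne_zero

end Series

/-! ### Crossed homomorphisms on free groups -/

section Crossed

variable {α R M : Type*} [CommRing R] [AddCommGroup M] [Module R M]

/-- The affine action of `FreeGroup α` on `M` in which the generator `a` acts as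
`m ↦ v a + ρ a m`. -/
def affineAction (ρ : FreeGroup α →* Module.End R M) (v : α → M) :
    FreeGroup α →* Equiv.Perm M :=
  FreeGroup.lift fun a =>
    { toFun := fun m => v a + ρ (FreeGroup.of a) m
      invFun := fun m => ρ (FreeGroup.of a)⁻¹ (m - v a)
      left_inv := fun m => by
        beta_reduce
        rw [add_sub_cancel_left, ← Module.End.mul_apply, ← map_mul, inv_mul_cancel, map_one,
          Module.End.one_apply]
      right_inv := fun m => by
        beta_reduce
        rw [← Module.End.mul_apply, ← map_mul, mul_inv_cancel, map_one, Module.End.one_apply,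
          add_sub_cancel] }

/-- The crossed homomorphism `c : FreeGroup α → M`, `c (g h) = c g + ρ g (c h)`, that takes the
value `v a` at the generator `a`; it is the translation part of `affineAction ρ v`. -/
def crossedHom (ρ : FreeGroup α →* Module.End R M) (v : α → M) (g : FreeGroup α) : M :=
  affineAction ρ v g 0

variable (ρ : FreeGroup α →* Module.End R M) (v : α → M)

theorem affineAction_apply (g : FreeGroup α) (m : M) :
    affineAction ρ v g m = crossedHom ρ v g + ρ g m := by
  induction g generalizing m with
  | C1 => simp [crossedHom]
  | of a => simp [crossedHom, affineAction]
  | inv_of a _ => simp [crossedHom, affineAction, Equiv.Perm.inv_def, sub_eq_neg_add]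
  | mul x y hx hy =>
    rw [crossedHom, map_mul, Equiv.Perm.mul_apply, Equiv.Perm.mul_apply, hy, hx, hx, hy 0,
      map_mul, Module.End.mul_apply]
    simp [add_assoc]

theorem crossedHom_mul (g h : FreeGroup α) :
    crossedHom ρ v (g * h) = crossedHom ρ v g + ρ g (crossedHom ρ v h) := by
  rw [crossedHom, map_mul, Equiv.Perm.mul_apply, affineAction_apply]
  rfl

@[simp]
theorem crossedHom_one : crossedHom ρ v 1 = 0 := by simp [crossedHom]

@[simp]
theorem crossedHom_of (a : α) : crossedHom ρ v (FreeGroup.of a) = v a := by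
  simp [crossedHom, affineAction]

theorem crossedHom_inv (g : FreeGroup α) :
    crossedHom ρ v g⁻¹ = -ρ g⁻¹ (crossedHom ρ v g) := by
  rw [eq_neg_iff_add_eq_zero, ← crossedHom_mul, inv_mul_cancel, crossedHom_one]

/-- The crossed homomorphism depends linearly on its values at the generators. -/
def crossedHomLinear (g : FreeGroup α) : (α → M) →ₗ[R] M where
  toFun v := crossedHom ρ v g
  map_add' v w := by
    induction g with
    | C1 => simp
    | of a => simp
    | inv_of a h => simp [crossedHom_inv, add_comm]
    | mul x y hx hy => simp only [crossedHom_mul, hx, hy, map_add]; abel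
  map_smul' r v := by
    induction g with
    | C1 => simp
    | of a => simp
    | inv_of a h => simp [crossedHom_inv]
    | mul x y hx hy => simp only [crossedHom_mul, hx, hy, map_smul, smul_add, RingHom.id_apply]

end Crossed

section Regular

variable {G : Type*} [Group G]

/-- The action of `G` by translation on the functions on `G ⧸ H`. -/
def quotientFunctions (R : Type*) [CommRing R] (H : Subgroup G) :
    G →* Module.End R (G ⧸ H → R) where
  toFun g := LinearMap.funLeft R R fun s => g⁻¹ • s
  map_one' := by ext; simp
  map_mul' g h := by
    refine LinearMap.ext fun f => funext fun s => ?_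
    simp [LinearMap.funLeft_apply, mul_smul]

@[simp]
theorem quotientFunctions_apply {R : Type*} [CommRing R] (H : Subgroup G) (g : G)
    (f : G ⧸ H → R) (s : G ⧸ H) : quotientFunctions R H g f s = f (g⁻¹ • s) := rfl

theorem Subgroup.smul_quotient_eq_self {H : Subgroup G} [H.Normal] {h : G} (hh : h ∈ H)
    (s : G ⧸ H) : h • s = s := by
  obtain ⟨x, rfl⟩ := QuotientGroup.mk_surjective s
  rw [MulAction.Quotient.smul_coe, QuotientGroup.eq]
  simpa [mul_assoc] using ‹H.Normal›.conj_mem _ (H.inv_mem hh) x⁻¹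

variable {α R : Type*} [CommRing R] (H : Subgroup (FreeGroup α)) [H.Normal]
  (v : α → FreeGroup α ⧸ H → R)

/-- Shapiro's map: a crossed homomorphism into the functions on `FreeGroup α ⧸ H`, evaluated at a
coset, is a homomorphism on `H`. -/
def shapiroHom (s : FreeGroup α ⧸ H) : H →* Multiplicative R where
  toFun h := Multiplicative.ofAdd (crossedHom (quotientFunctions R H) v h s)
  map_one' := by simp
  map_mul' x y := by
    rw [← ofAdd_add, Subgroup.coe_mul, crossedHom_mul, Pi.add_apply, quotientFunctions_apply,
      Subgroup.smul_quotient_eq_self (H.inv_mem x.2)]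

end Regular

/-! ### Residual properties of the series of a free group -/

section Girth

open FreeGroup

variable {α : Type*}

theorem crossedHom_mk_singleton {R M : Type*} [CommRing R] [AddCommGroup M] [Module R M]
    (ρ : FreeGroup α →* Module.End R M) (v : α → M) (a : α) (ε : Bool) :
    crossedHom ρ v (mk [(a, ε)]) = if ε then v a else -ρ (of a)⁻¹ (v a) := by
  cases ε
  · have : mk [(a, false)] = (of a)⁻¹ := rfl
    simp [this, crossedHom_inv]
  · exact crossedHom_of ρ v a

variable [DecidableEq α]

theorem FreeGroup.IsReduced.norm_mk {L : List (α × Bool)} (h : IsReduced L) :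
    norm (mk L) = L.length := by
  rw [norm, toWord_mk, h.reduce_eq]

/-- The girth of the Cayley graphs of the quotients by the terms of the series increases.
A shortest nontrivial word of `H` runs through a simple cycle in the Cayley graph of
`FreeGroup α ⧸ H`, so the crossed homomorphism given by the indicator function of its first edge
takes the value `±1` at it, whereas it vanishes modulo `p` on `[H, H] H ^ p`. -/
theorem exists_norm_lt_of_mem_verbalStep {H : Subgroup (FreeGroup α)} [H.Normal] {p : ℕ}
    (hp : 1 < p) {w : FreeGroup α} (hw : w ∈ verbalStep H p) (hw1 : w ≠ 1) :
    ∃ w' ∈ H, w' ≠ 1 ∧ w'.norm < w.norm := by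
  classical
  by_contra! hmin
  have hwH : w ∈ H := verbalStep_le H p hw
  obtain ⟨⟨a₀, ε₀⟩, L, hL⟩ := List.exists_cons_of_ne_nil (mt toWord_eq_nil_iff.1 hw1)
  have hred : IsReduced ((a₀, ε₀) :: L) := hL ▸ isReduced_toWord
  have hnorm : w.norm = L.length + 1 := by
    rw [FreeGroup.norm, hL, List.length_cons]
  have hshort : ∀ P : List (α × Bool), IsReduced P → P.length < L.length + 1 → mk P ∈ H →
      P = [] := by
    intro P hP hlen hmem
    by_contra hne
    have h1 : mk P ≠ 1 := by
      intro h
      have := hP.norm_mk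
      rw [h, FreeGroup.norm_one] at this
      exact hne (List.length_eq_zero_iff.1 this.symm)
    have := hmin _ hmem h1
    rw [hP.norm_mk, hnorm] at this
    omega
  -- the starting point of the first edge, oriented from `s₀` as the generator `a₀` prescribes
  let s₀ : FreeGroup α ⧸ H := if ε₀ then ((1 : FreeGroup α) : FreeGroup α ⧸ H) else
    ((of a₀ : FreeGroup α) : FreeGroup α ⧸ H)
  let v : α → FreeGroup α ⧸ H → ZMod p := fun a s => if a = a₀ ∧ s = s₀ then 1 else 0
  let c := crossedHom (quotientFunctions (ZMod p) H) v
  have hlast : ∀ S P : List (α × Bool), L = P ++ S →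
      c (mk S) (((mk ((a₀, ε₀) :: P))⁻¹ : FreeGroup α) : FreeGroup α ⧸ H) = 0 := by
    intro S
    induction S with
    | nil =>
      intro P _
      change crossedHom _ v (mk []) _ = 0
      rw [← one_eq_mk, crossedHom_one]
      rfl
    | cons b S ih =>
      intro P hP
      obtain ⟨a, ε⟩ := b
      have hmk : mk ((a, ε) :: S) = mk [(a, ε)] * mk S := by rw [mul_mk]; rfl
      have hu : mk ((a₀, ε₀) :: (P ++ [(a, ε)])) = mk ((a₀, ε₀) :: P) * mk [(a, ε)] := by
        rw [mul_mk]; rfl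
      have hnext := ih (P ++ [(a, ε)]) (by simpa using hP)
      rw [hu, mul_inv_rev] at hnext
      change crossedHom _ v _ _ = 0
      rw [hmk, crossedHom_mul, Pi.add_apply, quotientFunctions_apply,
        MulAction.Quotient.smul_coe, smul_eq_mul]
      refine (add_eq_left.2 hnext).trans ?_
      -- the closed path does not pass the first edge again in the same direction
      have hsame : mk ((a₀, ε₀) :: P) ∉ H := by
        intro hmem
        have := hshort ((a₀, ε₀) :: P) (hred.infix ⟨[], (a, ε) :: S, by simp [hP]⟩)
          (by simp [hP]) hmem
        simp at this
      -- nor in the opposite direction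
      have hopp : a = a₀ → ε ≠ ε₀ → mk P ∉ H := by
        intro ha hε hmem
        have := hshort P (hred.infix ⟨[(a₀, ε₀)], (a, ε) :: S, by simp [hP]⟩)
          (by simp [hP]) hmem
        subst this
        rw [hP] at hred
        exact hε ((isReduced_cons_cons.1 hred).1 ha.symm).symm
      have hu' : mk ((a₀, ε₀) :: P) = mk [(a₀, ε₀)] * mk P := by rw [mul_mk]; rfl
      have hof : mk [(a₀, true)] = of a₀ := rfl
      have hofi : mk [(a₀, false)] = (of a₀)⁻¹ := rfl
      rw [crossedHom_mk_singleton]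
      cases ε
      · simp only [Bool.false_eq_true, if_false, Pi.neg_apply, neg_eq_zero,
          quotientFunctions_apply, inv_inv, MulAction.Quotient.smul_coe, smul_eq_mul, v]
        rw [if_neg]
        rintro ⟨rfl, h⟩
        cases ε₀
        · simp only [s₀, Bool.false_eq_true, if_false] at h
          rw [QuotientGroup.eq] at h
          exact hsame (by simpa using h)
        · simp only [s₀, if_true] at h
          rw [QuotientGroup.eq, hu', hof] at h
          refine hopp rfl (by decide) ?_
          have := ‹H.Normal›.conj_mem _ h (of a)⁻¹
          simpa [mul_assoc] using this
      · simp only [if_true, v]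
        rw [if_neg]
        rintro ⟨rfl, h⟩
        cases ε₀
        · simp only [s₀, Bool.false_eq_true, if_false] at h
          rw [QuotientGroup.eq, hu', hofi] at h
          refine hopp rfl (by decide) ?_
          have := ‹H.Normal›.conj_mem _ h (of a)
          simpa [mul_assoc] using this
        · simp only [s₀, if_true] at h
          rw [QuotientGroup.eq] at h
          exact hsame (by simpa using h)
  have hfirst : c (mk [(a₀, ε₀)]) ((1 : FreeGroup α) : FreeGroup α ⧸ H) ≠ 0 := by
    have : Fact (1 < p) := ⟨hp⟩
    change crossedHom _ v _ _ ≠ 0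
    rw [crossedHom_mk_singleton]
    cases ε₀
    · have hs : of a₀ • ((1 : FreeGroup α) : FreeGroup α ⧸ H) = (of a₀ : FreeGroup α) := by
        rw [MulAction.Quotient.smul_coe, smul_eq_mul, mul_one]
      simp only [Bool.false_eq_true, if_false, Pi.neg_apply, quotientFunctions_apply, inv_inv, hs]
      simp [v, s₀]
    · simp [v, s₀]
  have hval : c w ((1 : FreeGroup α) : FreeGroup α ⧸ H) ≠ 0 := by
    have hw' : w = mk [(a₀, ε₀)] * mk L := by rw [mul_mk, ← mk_toWord (x := w), hL]; rfl
    change crossedHom _ v _ _ ≠ 0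
    rw [hw', crossedHom_mul, Pi.add_apply, quotientFunctions_apply, MulAction.Quotient.smul_coe,
      smul_eq_mul, mul_one]
    have := hlast L [] rfl
    rwa [(congrArg _ this).trans (add_zero _)]
  -- the crossed homomorphism restricts to a homomorphism from `H` to `ZMod p`
  let θ := shapiroHom H v ((1 : FreeGroup α) : FreeGroup α ⧸ H)
  have hker : verbalStep H p ≤ θ.ker.map H.subtype := by
    refine verbalStep_le_iff.2 ⟨fun x hx y hy => ?_, fun x hx => ?_⟩
    · refine ⟨⟨x, hx⟩ * ⟨y, hy⟩ * ⟨x, hx⟩⁻¹ * ⟨y, hy⟩⁻¹, ?_, rfl⟩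
      rw [SetLike.mem_coe, MonoidHom.mem_ker, _root_.map_mul, _root_.map_mul, _root_.map_mul,
        _root_.map_inv, _root_.map_inv, mul_inv_cancel_comm, mul_inv_cancel]
    · refine ⟨⟨x, hx⟩ ^ p, ?_, rfl⟩
      rw [SetLike.mem_coe, MonoidHom.mem_ker, map_pow]
      apply Multiplicative.toAdd.injective
      rw [toAdd_pow, nsmul_eq_mul, CharP.cast_eq_zero, zero_mul, toAdd_one]
  obtain ⟨y, hy, rfl⟩ := hker hw
  exact hval (Multiplicative.ofAdd.injective (MonoidHom.mem_ker.1 hy))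

theorem le_norm_of_mem_gammaSeries {q : ℕ → ℕ} (hq : ∀ i, 1 < q i) (i : ℕ) {w : FreeGroup α}
    (hw : w ∈ gammaSeries (FreeGroup α) q i) (hw1 : w ≠ 1) : i ≤ w.norm := by
  induction i generalizing w with
  | zero => exact Nat.zero_le _
  | succ i ih =>
    obtain ⟨w', hw', hne, hlt⟩ := exists_norm_lt_of_mem_verbalStep (hq i) hw hw1
    exact (ih hw' hne).trans_lt hlt

/-- The order of a nontrivial element of a free group modulo the terms of the series tends to
infinity. -/
theorem eventually_pow_notMem_gammaSeries {q : ℕ → ℕ} (hq : ∀ i, 1 < q i)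
    {f : FreeGroup α} (hf : f ≠ 1) (s : ℕ) :
    ∀ᶠ i in Filter.atTop, ∀ k, 0 < k → k ≤ s → f ^ k ∉ gammaSeries (FreeGroup α) q i := by
  filter_upwards [Filter.eventually_gt_atTop (f ^ s.factorial).norm] with i hi k hk hks hmem
  obtain ⟨d, hd⟩ := Nat.dvd_factorial hk hks
  have h1 : f ^ s.factorial ≠ 1 := by
    simp [hf, Nat.factorial_ne_zero]
  have h2 : f ^ s.factorial ∈ gammaSeries (FreeGroup α) q i := by
    rw [hd, pow_mul]
    exact Subgroup.pow_mem _ hmem d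
  have := le_norm_of_mem_gammaSeries hq i h2 h1
  omega

end Girth

/-! ### The rank of a subgroup of finite index -/

section Rank

open FreeGroup

variable {α : Type*}

/-- A weak form of the Schreier index formula. The crossed homomorphisms into the functions
`FreeGroup α ⧸ K → ℤ` supported on two generators form a module of rank `2 [F : K]`. Such a
crossed homomorphism is determined by the homomorphism it induces on `K` and by its values at
coset representatives, and these range over a module of rank `|X| + [F : K]`. -/
theorem index_le_card_of_equiv (K : Subgroup (FreeGroup α)) [K.Normal] [K.FiniteIndex]
    {a b : α} (hab : a ≠ b) {X : Type*} [Finite X] (e : K ≃* FreeGroup X) :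
    K.index ≤ Nat.card X := by
  classical
  have := Fintype.ofFinite X
  let S := FreeGroup α ⧸ K
  have : Fintype S := Fintype.ofFinite S
  let ρ := quotientFunctions ℤ K
  let extend : (Bool × S → ℤ) →ₗ[ℤ] (α → S → ℤ) :=
    { toFun := fun f x s => if x = a then f (true, s) else if x = b then f (false, s) else 0
      map_add' := fun f g => by
        ext x s; simp only [Pi.add_apply]; split_ifs <;> simp
      map_smul' := fun r f => by
        ext x s; simp only [Pi.smul_apply, RingHom.id_apply]; split_ifs <;> simp }
  let val : (α → S → ℤ) →ₗ[ℤ] (X ⊕ S → ℤ) := LinearMap.pi fun t =>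
    LinearMap.proj ((1 : FreeGroup α) : S) ∘ₗ crossedHomLinear ρ
      (Sum.elim (fun x => (e.symm (of x) : FreeGroup α)) Quotient.out t)
  have hinj : Function.Injective (val ∘ₗ extend) := by
    rw [injective_iff_map_eq_zero]
    intro f hf
    let c := crossedHom ρ (extend f)
    have hX : ∀ x, c (e.symm (of x)) ((1 : FreeGroup α) : S) = 0 := fun x =>
      congrFun hf (Sum.inl x)
    have hS : ∀ s : S, c s.out ((1 : FreeGroup α) : S) = 0 := fun s => congrFun hf (Sum.inr s)
    have hK : ∀ k ∈ K, c k ((1 : FreeGroup α) : S) = 0 := by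
      have : (shapiroHom K (extend f) ((1 : FreeGroup α) : S)).comp e.symm.toMonoidHom = 1 := by
        ext x
        exact hX x
      intro k hk
      have := DFunLike.congr_fun this (e ⟨k, hk⟩)
      simp only [MonoidHom.comp_apply, MulEquiv.toMonoidHom_eq_coe, MonoidHom.coe_coe,
        MulEquiv.symm_apply_apply] at this
      exact Multiplicative.ofAdd.injective this
    have hall : ∀ g, c g ((1 : FreeGroup α) : S) = 0 := by
      intro g
      have hk : g * (Quotient.out (g : S))⁻¹ ∈ K := by
        have h := QuotientGroup.eq.1 (QuotientGroup.out_eq' (g : S))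
        have := ‹K.Normal›.conj_mem _ h (Quotient.out (g : S))
        simpa [mul_assoc] using this
      have hg : g = (g * (Quotient.out (g : S))⁻¹) * Quotient.out (g : S) := by group
      change crossedHom ρ (extend f) g _ = 0
      rw [hg, crossedHom_mul, Pi.add_apply, quotientFunctions_apply,
        Subgroup.smul_quotient_eq_self (K.inv_mem hk)]
      exact (congrArg₂ _ (hK _ hk) (hS _)).trans (add_zero 0)
    have hzero : ∀ g, c g = 0 := by
      intro g
      ext s
      obtain ⟨h, rfl⟩ := QuotientGroup.mk_surjective s
      have := hall (h⁻¹ * g)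
      change crossedHom ρ (extend f) (h⁻¹ * g) _ = 0 at this
      rw [crossedHom_mul, Pi.add_apply, quotientFunctions_apply, inv_inv,
        MulAction.Quotient.smul_coe, smul_eq_mul, mul_one] at this
      have h0 : crossedHom ρ (extend f) h⁻¹ ((1 : FreeGroup α) : S) = 0 := hall h⁻¹
      rw [h0, zero_add] at this
      exact this
    ext ⟨ε, s⟩
    cases ε
    · have := congrFun (hzero (of b)) s
      simpa [c, extend, hab.symm] using this
    · have := congrFun (hzero (of a)) s
      simpa [c, extend] using this
  have h := card_le_of_injective ℤ (val ∘ₗ extend) hinj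
  rw [Fintype.card_prod, Fintype.card_bool, Fintype.card_sum] at h
  rw [Subgroup.index, Nat.card_eq_fintype_card, Nat.card_eq_fintype_card]
  change Fintype.card S ≤ _
  omega

end Rank

/-! ### Groups with two more generators than relators -/

section Wreath

open FreeGroup LaurentPolynomial Filter

/-- The exponent sum of the letter `b` in an element of the free group on two letters. -/
def exponentSum (b : Bool) : FreeGroup Bool →* Multiplicative ℤ :=
  FreeGroup.lift fun c => if c = b then Multiplicative.ofAdd 1 else 1

/-- For a Laurent polynomial `f = ∑ fⱼ Tʲ`, the function `ℤ → FreeGroup {y, z}` whose value at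
`n / 2 + j + q n`, where `-n / 2 ≤ j < n - n / 2`, is the conjugate of `z ^ fⱼ` by `y ^ (-q)`;
here `y` and `z` are the letters `true` and `false`. -/
def twistedPower (n : ℕ) (f : ℤ[T;T⁻¹]) (i : ℤ) : FreeGroup Bool :=
  of true ^ (-(i / n)) * of false ^ (f.coeff (i % n - n / 2)) * of true ^ (i / n)

theorem twistedPower_zero (n : ℕ) (i : ℤ) : twistedPower n 0 i = 1 := by
  simp [twistedPower]

theorem twistedPower_add (n : ℕ) (f g : ℤ[T;T⁻¹]) (i : ℤ) :
    twistedPower n (f + g) i = twistedPower n f i * twistedPower n g i := by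
  simp only [twistedPower, AddMonoidAlgebra.coeff_add, Finsupp.add_apply]
  group

theorem twistedPower_neg (n : ℕ) (f : ℤ[T;T⁻¹]) (i : ℤ) :
    twistedPower n (-f) i = (twistedPower n f i)⁻¹ := by
  rw [eq_inv_iff_mul_eq_one, ← twistedPower_add, neg_add_cancel, twistedPower_zero]

theorem twistedPower_sub_mul {n : ℕ} (hn : n ≠ 0) (f : ℤ[T;T⁻¹]) (i k : ℤ) :
    twistedPower n f (i - k * n) =
      of true ^ k * twistedPower n f i * of true ^ (-k) := by
  have hn' : (n : ℤ) ≠ 0 := by exact_mod_cast hn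
  have h1 : (i - k * n) / n = i / n - k := Int.sub_mul_ediv_right _ _ hn'
  have h2 : (i - k * n) % n = i % n := by simp
  simp only [twistedPower, h1, h2]
  group

theorem exponentSum_true_twistedPower (n : ℕ) (f : ℤ[T;T⁻¹]) (i : ℤ) :
    exponentSum true (twistedPower n f i) = 1 := by
  simp [twistedPower, exponentSum]

theorem coeff_T_mul (k j : ℤ) (f : ℤ[T;T⁻¹]) : (T k * f).coeff j = f.coeff (j - k) := by
  rw [T, AddMonoidAlgebra.coeff_single_mul_apply, one_mul, neg_add_eq_sub]

theorem exists_bound_coeff (f : ℤ[T;T⁻¹]) : ∃ C : ℕ, ∀ j : ℤ, (C : ℤ) < |j| → f.coeff j = 0 := by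
  refine ⟨f.coeff.support.sup Int.natAbs, fun j hj => ?_⟩
  by_contra h
  have := Finset.le_sup (f := Int.natAbs) (Finsupp.mem_support_iff.2 h)
  rw [Int.abs_eq_natAbs] at hj
  omega

/-- The twist by `y` takes place only at the multiples of `n`, where for large `n` the
coefficients vanish. -/
theorem eventually_twistedPower_sub_one (f : ℤ[T;T⁻¹]) :
    ∀ᶠ n : ℕ in atTop, ∀ i : ℤ, twistedPower n f (i - 1) = twistedPower n (T 1 * f) i := by
  obtain ⟨C, hC⟩ := exists_bound_coeff f
  filter_upwards [eventually_ge_atTop (2 * C + 4)] with n hn i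
  have hn' : (n : ℤ) ≠ 0 := by omega
  have hnpos : (0 : ℤ) < n := by omega
  simp only [twistedPower, coeff_T_mul]
  have h0 := Int.emod_nonneg i hn'
  have h1 := Int.emod_lt_of_pos i hnpos
  have h2 := Int.emod_add_mul_ediv i n
  by_cases h : i % n = 0
  · have hi : i - 1 = (n - 1) + (i / n - 1) * n := by linear_combination h - h2
    have hd : (i - 1) / n = i / n - 1 := by
      rw [hi, Int.add_mul_ediv_right _ _ hn', Int.ediv_eq_zero_of_lt (by omega) (by omega),
        zero_add]
    have hm : (i - 1) % n = n - 1 := by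
      rw [hi, Int.add_mul_emod_self_right, Int.emod_eq_of_lt (by omega) (by omega)]
    rw [hd, hm, h, hC, hC]
    · simp only [zpow_zero, mul_one, ← zpow_add, neg_add_cancel]
    · rw [lt_abs]; omega
    · rw [lt_abs]; omega
  · have hi : i - 1 = (i % n - 1) + (i / n) * n := by linear_combination - h2
    have hd : (i - 1) / n = i / n := by
      rw [hi, Int.add_mul_ediv_right _ _ hn', Int.ediv_eq_zero_of_lt (by omega) (by omega),
        zero_add]
    have hm : (i - 1) % n = i % n - 1 := by
      rw [hi, Int.add_mul_emod_self_right, Int.emod_eq_of_lt (by omega) (by omega)]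
    rw [hd, hm, sub_right_comm]

theorem eventually_twistedPower_sub (k : ℤ) (f : ℤ[T;T⁻¹]) :
    ∀ᶠ n : ℕ in atTop, ∀ i : ℤ, twistedPower n f (i - k) = twistedPower n (T k * f) i := by
  induction k with
  | zero => simp
  | succ k ih =>
    filter_upwards [ih, eventually_twistedPower_sub_one (T k * f)] with n h1 h2 i
    rw [show i - (k + 1 : ℤ) = i - 1 - k by ring, h1, h2, ← mul_assoc, ← T_add, add_comm]
  | pred k ih =>
    filter_upwards [ih, eventually_twistedPower_sub_one (T (-k - 1) * f)] with n h1 h2 i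
    have := h2 (i + 1)
    rw [add_sub_cancel_right, ← mul_assoc, ← T_add, add_sub_cancel] at this
    rw [this, ← h1]
    congr 1
    ring

variable {X : Type*} (τ : FreeGroup X →* Multiplicative ℤ) (v : X → ℤ[T;T⁻¹])

/-- The action of `FreeGroup X` on the Laurent polynomials in which `g` multiplies by `T ^ τ g`. -/
noncomputable def laurentAction : FreeGroup X →* Module.End ℤ[T;T⁻¹] ℤ[T;T⁻¹] where
  toFun g := LinearMap.mulLeft _ (T (τ g).toAdd)
  map_one' := by ext; simp
  map_mul' g h := by
    refine LinearMap.ext fun f => ?_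
    change T _ * f = T _ * (T _ * f)
    rw [_root_.map_mul, toAdd_mul, T_add, mul_assoc]

@[simp]
theorem laurentAction_apply (g : FreeGroup X) (f : ℤ[T;T⁻¹]) :
    laurentAction τ g f = T (τ g).toAdd * f := rfl

/-- The homomorphism to the wreath product of `FreeGroup {y, z}` with `ℤ` that approximates
`g ↦ (c g, τ g)`, where `c` is the crossed homomorphism to the Laurent polynomials with values `v`
at the generators. -/
noncomputable def wreathHom (n : ℕ) : FreeGroup X →* FreeGroup Bool ≀ᵣ Multiplicative ℤ :=
  FreeGroup.lift fun x => ⟨fun i => twistedPower n (v x) i.toAdd, τ (of x)⟩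

@[simp]
theorem wreathHom_of (n : ℕ) (x : X) :
    wreathHom τ v n (of x) = ⟨fun i => twistedPower n (v x) i.toAdd, τ (of x)⟩ := by
  simp [wreathHom]

@[simp]
theorem wreathHom_right (n : ℕ) (g : FreeGroup X) : (wreathHom τ v n g).right = τ g := by
  have : RegularWreathProduct.rightHom.comp (wreathHom τ v n) = τ := by
    ext x
    simp
  exact DFunLike.congr_fun this g

theorem eventually_wreathHom_left (g : FreeGroup X) :
    ∀ᶠ n in atTop, ∀ i, (wreathHom τ v n g).left i =
      twistedPower n (crossedHom (laurentAction τ) v g) i.toAdd := by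
  induction g with
  | C1 => simp [twistedPower_zero]
  | of x => simp
  | inv_of x h =>
    filter_upwards [h, eventually_twistedPower_sub (τ (of x)⁻¹).toAdd (v x)] with n h1 h2 i
    simp only [_root_.map_inv, RegularWreathProduct.inv_left, Pi.inv_apply]
    rw [h1, crossedHom_inv, twistedPower_neg, crossedHom_of, laurentAction_apply, ← h2,
      wreathHom_right]
    simp [add_comm]
  | mul g h hg hh =>
    filter_upwards [hg, hh, eventually_twistedPower_sub (τ g).toAdd
      (crossedHom (laurentAction τ) v h)] with n h1 h2 h3 i
    rw [_root_.map_mul, RegularWreathProduct.mul_left, Pi.mul_apply, h1, h2, crossedHom_mul,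
      twistedPower_add, laurentAction_apply, ← h3, wreathHom_right]
    simp [neg_add_eq_sub]

theorem wreathHom_left_sub_mul {n : ℕ} (hn : n ≠ 0) (g : FreeGroup X) (i k : ℤ) :
    (wreathHom τ v n g).left (Multiplicative.ofAdd (i - k * n)) =
      of true ^ k * (wreathHom τ v n g).left (Multiplicative.ofAdd i) * of true ^ (-k) := by
  induction g generalizing i with
  | C1 => simp
  | of x => simpa [mul_comm k] using twistedPower_sub_mul hn (v x) i k
  | inv_of x h =>
    have h' := h ((τ (of x)).toAdd + i)
    simp only [_root_.map_inv, RegularWreathProduct.inv_left, Pi.inv_apply, wreathHom_right]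
    rw [add_sub_assoc, ofAdd_add, ofAdd_toAdd, ofAdd_add, ofAdd_toAdd] at h'
    rw [h']
    group
  | mul g h hg hh =>
    have h' := hh (-(τ g).toAdd + i)
    rw [_root_.map_mul, RegularWreathProduct.mul_left, Pi.mul_apply, Pi.mul_apply, hg,
      wreathHom_right]
    rw [add_sub_assoc, ofAdd_add, ofAdd_neg, ofAdd_toAdd, ofAdd_add, ofAdd_neg, ofAdd_toAdd] at h'
    rw [h']
    group

theorem exponentSum_true_wreathHom_left (n : ℕ) (g : FreeGroup X) (i : Multiplicative ℤ) :
    exponentSum true ((wreathHom τ v n g).left i) = 1 := by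
  induction g generalizing i with
  | C1 => simp
  | of x => simp [exponentSum_true_twistedPower]
  | inv_of x h => simp only [_root_.map_inv, RegularWreathProduct.inv_left,
      Pi.inv_apply, h, inv_one]
  | mul g h hg hh => rw [_root_.map_mul, RegularWreathProduct.mul_left, Pi.mul_apply,
      _root_.map_mul, hg, hh, one_mul]

/-- On the elements `h` for which `n` divides `τ h`, a component of `wreathHom` is a homomorphism
up to the twist by a power of `y`. -/
noncomputable def wreathComponent {n : ℕ} (hn : n ≠ 0) (i : ℤ) :
    (Subgroup.zpowers (Multiplicative.ofAdd (n : ℤ))).comap τ →* FreeGroup Bool where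
  toFun h := (wreathHom τ v n h).left (Multiplicative.ofAdd i) * of true ^ ((τ h).toAdd / n)
  map_one' := by simp
  map_mul' := by
    rintro ⟨g, hg⟩ ⟨h, hh⟩
    obtain ⟨k, hk⟩ := Subgroup.mem_zpowers_iff.1 (Subgroup.mem_comap.1 hg)
    obtain ⟨l, hl⟩ := Subgroup.mem_zpowers_iff.1 (Subgroup.mem_comap.1 hh)
    have hn' : (n : ℤ) ≠ 0 := by exact_mod_cast hn
    have h1 := wreathHom_left_sub_mul τ v hn h i k
    simp only [MulMemClass.mk_mul_mk, _root_.map_mul,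
      RegularWreathProduct.mul_left, Pi.mul_apply, wreathHom_right, ← hk, ← hl, toAdd_mul,
      toAdd_zpow, toAdd_ofAdd, smul_eq_mul]
    rw [← add_mul, Int.mul_ediv_cancel _ hn', Int.mul_ediv_cancel _ hn',
      Int.mul_ediv_cancel _ hn']
    have h2 : (Multiplicative.ofAdd (n : ℤ) ^ k)⁻¹ * Multiplicative.ofAdd i =
        Multiplicative.ofAdd (i - k * n) := by
      apply Multiplicative.toAdd.injective
      simp [neg_add_eq_sub, mul_comm k]
    rw [h2, h1]
    group

theorem exists_ne_zero_of_card_lt {R ι : Type*} [CommRing R] [Nontrivial R] [Fintype ι] {N : ℕ}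
    {j : Fin N → X} (hj : Function.Injective j) (hN : Fintype.card ι < N)
    (A : (X → R) →ₗ[R] (ι → R)) :
    ∃ u : X → R, u ≠ 0 ∧ A u = 0 ∧ ∀ x, x ∉ Set.range j → u x = 0 := by
  have hni : ¬ Function.Injective (A ∘ₗ Function.ExtendByZero.linearMap R j) := fun h => by
    have := card_le_of_injective R _ h
    rw [Fintype.card_fin] at this
    omega
  rw [injective_iff_map_eq_zero] at hni
  push Not at hni
  obtain ⟨f, hf, hf0⟩ := hni
  refine ⟨Function.extend j f 0, fun h => hf0 ?_, hf, fun x hx => ?_⟩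
  · ext k
    rw [← hj.extend_apply f 0 k, h]
    rfl
  · rw [Function.extend_apply' _ _ _ (by simpa using hx)]
    rfl

/-- A form of the theorem of Baumslag and Pride: a group with at least two more generators than
relators has, for each large `n`, a homomorphism from a subgroup of index dividing `n`, the
preimage of `n ℤ` under a homomorphism `τ` to `ℤ`, to the free group on two letters with
nonabelian image. Solving a linear system over `ℤ` gives `τ`, and a linear system over `ℤ[T;T⁻¹]`
gives a crossed homomorphism, both vanishing on the relators. -/
theorem exists_hom_of_card_add_two_le (R : Finset (FreeGroup X)) {j : Fin (R.card + 2) → X}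
    (hj : Function.Injective j) :
    ∃ τ : FreeGroup X →* Multiplicative ℤ, ∃ n₀ : ℕ, ∀ n ≥ n₀,
      ∃ ρ : (Subgroup.zpowers (Multiplicative.ofAdd (n : ℤ))).comap τ →* FreeGroup Bool,
        (∀ h, h.1 ∈ Subgroup.normalClosure (R : Set (FreeGroup X)) → ρ h = 1) ∧
        ∃ h₁ h₂, exponentSum true (ρ h₁) = 1 ∧ exponentSum false (ρ h₁) ≠ 1 ∧
          exponentSum true (ρ h₂) ≠ 1 := by
  obtain ⟨u, hu0, hu, huj⟩ := exists_ne_zero_of_card_lt hj (by simp)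
    (LinearMap.pi fun r : R => crossedHomLinear (1 : FreeGroup X →* Module.End ℤ ℤ) r.1)
  let τ : FreeGroup X →* Multiplicative ℤ :=
    { toFun := fun g => Multiplicative.ofAdd (crossedHom (1 : FreeGroup X →* Module.End ℤ ℤ) u g)
      map_one' := by simp
      map_mul' := fun g h => by simp [crossedHom_mul] }
  have hτR : ∀ r ∈ R, τ r = 1 := fun r hr => congrArg Multiplicative.ofAdd (congrFun hu ⟨r, hr⟩)
  obtain ⟨x₁, hx₁⟩ := Function.ne_iff.1 hu0
  have hτ₁ : (τ (of x₁)).toAdd ≠ 0 := by simpa [τ] using hx₁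
  obtain ⟨k₁, rfl⟩ : x₁ ∈ Set.range j := by
    by_contra h
    exact hx₁ (huj _ h)
  -- the value at `j k₁` is kept zero, which excludes the principal crossed homomorphisms
  obtain ⟨v, hv0, hv, hvj⟩ := exists_ne_zero_of_card_lt
    (hj.comp (Fin.succAbove_right_injective (p := k₁))) (by simp)
    (LinearMap.pi fun r : R => crossedHomLinear (laurentAction τ) r.1)
  have hv₁ : v (j k₁) = 0 := by
    apply hvj
    rintro ⟨k, hk⟩
    exact Fin.succAbove_ne _ _ (hj hk)
  obtain ⟨x₂, hx₂⟩ := Function.ne_iff.1 hv0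
  have hvR : ∀ r ∈ R, crossedHom (laurentAction τ) v r = 0 := fun r hr => congrFun hv ⟨r, hr⟩
  let w := of (j k₁) * of x₂ * (of (j k₁))⁻¹ * (of x₂)⁻¹
  have hτw : τ w = 1 := by
    simp only [w, _root_.map_mul, _root_.map_inv]
    rw [mul_inv_cancel_comm, mul_inv_cancel]
  have hcw : crossedHom (laurentAction τ) v w = (T (τ (of (j k₁))).toAdd - 1) * v x₂ := by
    have hT : ∀ k : ℤ, (T k * T (-k) : ℤ[T;T⁻¹]) = 1 := fun k => by
      rw [← T_add, add_neg_cancel, T_zero]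
    simp only [w, crossedHom_mul, crossedHom_inv, crossedHom_of, hv₁, laurentAction_apply,
      _root_.map_mul, _root_.map_inv, toAdd_inv, Module.End.mul_apply, mul_zero, neg_zero]
    linear_combination -v x₂ * (T (τ (of x₂)).toAdd * T (-(τ (of x₂)).toAdd)) *
      hT (τ (of (j k₁))).toAdd - v x₂ * hT (τ (of x₂)).toAdd
  have hcw0 : crossedHom (laurentAction τ) v w ≠ 0 := by
    rw [hcw]
    refine mul_ne_zero (sub_ne_zero.2 fun h => hτ₁ ?_) hx₂
    have := congrArg (fun f : ℤ[T;T⁻¹] => f.coeff 0) h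
    rw [← T_zero] at this
    simp only [T_apply] at this
    simpa using this
  obtain ⟨d, hd⟩ : ∃ d, (crossedHom (laurentAction τ) v w).coeff d ≠ 0 := by
    by_contra! h
    exact hcw0 (AddMonoidAlgebra.ext (Finsupp.ext h))
  have hev : ∀ᶠ n in atTop, ∀ r ∈ R, ∀ i, (wreathHom τ v n r).left i = 1 := by
    rw [Filter.eventually_all_finset]
    intro r hr
    filter_upwards [eventually_wreathHom_left τ v r] with n hn i
    rw [hn, hvR r hr, twistedPower_zero]
  obtain ⟨n₀, hn₀⟩ := eventually_atTop.1 ((hev.and (eventually_wreathHom_left τ v w)).and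
    (eventually_ge_atTop (2 * d.natAbs + 2)))
  refine ⟨τ, n₀, fun n hn => ?_⟩
  obtain ⟨⟨hR, hw⟩, hnd⟩ := hn₀ n hn
  have hn0 : n ≠ 0 := by omega
  refine ⟨wreathComponent τ v hn0 (n / 2 + d), fun h hh => ?_, ⟨w, ?_⟩, ⟨of (j k₁) ^ n, ?_⟩, ?_⟩
  · have hker : Subgroup.normalClosure (R : Set (FreeGroup X)) ≤ (wreathHom τ v n).ker := by
      refine Subgroup.normalClosure_le_normal fun r hr => MonoidHom.mem_ker.2 ?_
      ext1
      · exact funext (hR r hr)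
      · rw [wreathHom_right, hτR r hr, RegularWreathProduct.one_right]
    have h1 := MonoidHom.mem_ker.1 (hker hh)
    have h2 := wreathHom_right τ v n h
    rw [h1, RegularWreathProduct.one_right] at h2
    change (wreathHom τ v n h).left _ * _ = 1
    rw [h1, ← h2]
    simp
  · rw [Subgroup.mem_comap, hτw]
    exact one_mem _
  · rw [Subgroup.mem_comap, map_pow]
    exact Subgroup.mem_zpowers_iff.2 ⟨(τ (of (j k₁))).toAdd, by
      apply Multiplicative.toAdd.injective; simp [mul_comm]⟩
  · refine ⟨?_, ?_, ?_⟩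
    · change exponentSum true ((wreathHom τ v n w).left _ * _) = 1
      rw [hτw, _root_.map_mul, exponentSum_true_wreathHom_left]
      simp
    · change exponentSum false ((wreathHom τ v n w).left _ * _) ≠ 1
      rw [hτw, hw, twistedPower, toAdd_ofAdd, Int.ediv_eq_zero_of_lt (by omega) (by omega),
        Int.emod_eq_of_lt (by omega) (by omega), add_sub_cancel_left]
      have : (crossedHom (laurentAction τ) v w).coeff d ≠ 0 := hd
      simpa [exponentSum, ← ofAdd_zsmul] using this
    · change exponentSum true ((wreathHom τ v n (of (j k₁) ^ n)).left _ * _) ≠ 1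
      have hn' : (n : ℤ) ≠ 0 := by exact_mod_cast hn0
      rw [_root_.map_mul, exponentSum_true_wreathHom_left, one_mul, map_pow τ, toAdd_pow,
        nsmul_eq_mul, Int.mul_ediv_cancel_left _ hn']
      simpa [exponentSum, ← ofAdd_zsmul] using hτ₁

end Wreath

/-! ### Quotients of the terms of the series -/

section Criterion

open FreeGroup

theorem FreeGroup.of_mul_of_ne {α : Type*} {a b : α} (hab : a ≠ b) :
    of a * of b ≠ of b * of a := by
  classical
  intro h
  have h1 : (of a * of b).toWord = [(a, true), (b, true)] := by simp [toWord_mul, reduce.cons]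
  have h2 : (of b * of a).toWord = [(b, true), (a, true)] := by simp [toWord_mul, reduce.cons]
  rw [h, h2] at h1
  simp [hab.symm] at h1

theorem FreeGroup.exists_forall_mem_zpowers (α : Type*) [Subsingleton α] :
    ∃ c : FreeGroup α, ∀ g, g ∈ Subgroup.zpowers c := by
  rcases isEmpty_or_nonempty α with h | ⟨⟨a⟩⟩
  · exact ⟨1, fun g => by rw [Subsingleton.elim g 1]; exact one_mem _⟩
  · refine ⟨of a, fun g => ?_⟩
    induction g with
    | C1 => exact one_mem _
    | of x => rw [Subsingleton.elim x a]; exact Subgroup.mem_zpowers _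
    | inv_of x h => exact inv_mem h
    | mul x y hx hy => exact mul_mem hx hy

/-- The image of such a homomorphism is free by the theorem of Nielsen and Schreier, and it is not
cyclic since two of its elements have linearly independent exponent sums. -/
theorem mapsOntoNonabelianFree_of_exponentSum.{u} {L : Type u} [Group L] (f : L →* FreeGroup Bool)
    {h₁ h₂ : L} (h₁t : exponentSum true (f h₁) = 1) (h₁f : exponentSum false (f h₁) ≠ 1)
    (h₂t : exponentSum true (f h₂) ≠ 1) : MapsOntoNonabelianFree L := by
  let X := IsFreeGroup.Generators f.range
  let e : f.range ≃* FreeGroup (ULift.{u} X) :=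
    (IsFreeGroup.toFreeGroup f.range).trans (freeGroupCongr Equiv.ulift.symm)
  refine ⟨ULift.{u} X, ?_, e.toMonoidHom.comp f.rangeRestrict,
    e.surjective.comp f.rangeRestrict_surjective⟩
  by_contra! hcomm
  have : Subsingleton (ULift.{u} X) :=
    ⟨fun a b => by_contra fun hab => of_mul_of_ne hab (hcomm _ _)⟩
  obtain ⟨c, hc⟩ := exists_forall_mem_zpowers (ULift.{u} X)
  have hf : ∀ h, ∃ k : ℤ, f h = (e.symm c : FreeGroup Bool) ^ k := fun h => by
    obtain ⟨k, hk⟩ := Subgroup.mem_zpowers_iff.1 (hc (e (f.rangeRestrict h)))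
    refine ⟨k, ?_⟩
    rw [← Subgroup.coe_zpow, ← map_zpow, hk, MulEquiv.symm_apply_apply, MonoidHom.coe_rangeRestrict]
  obtain ⟨k, hk⟩ := hf h₁
  obtain ⟨l, hl⟩ := hf h₂
  rw [hk, map_zpow] at h₁t h₁f
  rw [hl, map_zpow] at h₂t
  have hk0 : k ≠ 0 := by rintro rfl; exact h₁f (zpow_zero _)
  rw [IsMulTorsionFree.zpow_eq_one_iff_left hk0] at h₁t
  exact h₂t (by rw [h₁t, one_zpow])

end Criterion

section FreeSeries

open FreeGroup

variable {α : Type*}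

theorem exists_injective_fin {X : Type*} {N : ℕ} (h : Finite X → N ≤ Nat.card X) :
    ∃ j : Fin N → X, Function.Injective j := by
  rcases finite_or_infinite X with hX | hX
  · exact ⟨(Finite.equivFin X).symm ∘ Fin.castLE (h hX),
      (Finite.equivFin X).symm.injective.comp (Fin.castLE_injective _)⟩
  · exact ⟨Infinite.natEmbedding X ∘ Fin.val,
      (Infinite.natEmbedding X).injective.comp Fin.val_injective⟩

/-- A homomorphism from a term of the series to `ℤ` takes values divisible by
`q j₀ ⋯ q (j₀ + i - 1)` at the elements of the `i`-th following term. -/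
theorem gammaSeries_add_le_map_comap {G : Type*} [Group G] (q : ℕ → ℕ) (j₀ i : ℕ)
    (τ : gammaSeries G q j₀ →* Multiplicative ℤ) :
    gammaSeries G q (j₀ + i) ≤ ((Subgroup.zpowers (Multiplicative.ofAdd
      ((∏ k ∈ Finset.range i, q (j₀ + k) : ℕ) : ℤ))).comap τ).map
        (gammaSeries G q j₀).subtype := by
  induction i with
  | zero =>
    intro x hx
    refine ⟨⟨x, hx⟩, Subgroup.mem_comap.2 (Subgroup.mem_zpowers_iff.2 ⟨(τ ⟨x, hx⟩).toAdd, ?_⟩), rfl⟩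
    apply Multiplicative.toAdd.injective
    simp
  | succ i ih =>
    rw [← add_assoc, gammaSeries_succ]
    refine verbalStep_le_iff.2 ⟨fun x hx y hy => ?_, fun x hx => ?_⟩
    · obtain ⟨x, -, rfl⟩ := ih hx
      obtain ⟨y, -, rfl⟩ := ih hy
      refine ⟨x * y * x⁻¹ * y⁻¹, Subgroup.mem_comap.2 ?_, rfl⟩
      rw [_root_.map_mul, _root_.map_mul, _root_.map_mul, _root_.map_inv, _root_.map_inv,
        mul_inv_cancel_comm, mul_inv_cancel]
      exact one_mem _
    · obtain ⟨x, h, rfl⟩ := ih hx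
      obtain ⟨k, hk⟩ := Subgroup.mem_zpowers_iff.1 (Subgroup.mem_comap.1 h)
      refine ⟨x ^ q (j₀ + i), Subgroup.mem_comap.2 (Subgroup.mem_zpowers_iff.2 ⟨k, ?_⟩), rfl⟩
      rw [map_pow, ← hk, Finset.prod_range_succ]
      apply Multiplicative.toAdd.injective
      simp only [toAdd_zpow, toAdd_pow, toAdd_ofAdd, smul_eq_mul, nsmul_eq_mul]
      push_cast
      ring

/-- The powers `f ^ o`, where `o` is the order of `f` modulo `K`, conjugated by representatives of
the cosets `(F ⧸ K) ⧸ ⟨f⟩`. -/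
noncomputable def conjugatePower {F : Type*} [Group F] (K : Subgroup F) [K.Normal] (f : F)
    (s : (F ⧸ K) ⧸ Subgroup.zpowers (f : F ⧸ K)) : K :=
  ⟨s.out.out * f ^ orderOf (f : F ⧸ K) * s.out.out⁻¹, ‹K.Normal›.conj_mem _ (by
    rw [← QuotientGroup.eq_one_iff, QuotientGroup.mk_pow, pow_orderOf_eq_one]) _⟩

/-- As `f` commutes with its powers, these conjugates suffice to generate, as a normal subgroup of
`K`, all the conjugates of powers of `f` in `K`. -/
theorem conj_pow_mem_of_conjugatePower_mem {F : Type*} [Group F] {K : Subgroup F} [K.Normal] {f : F}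
    {V : Subgroup K} [V.Normal] (hV : ∀ s, conjugatePower K f s ∈ V) {g : F} {n : ℕ}
    (h : g * f ^ n * g⁻¹ ∈ K) : (⟨g * f ^ n * g⁻¹, h⟩ : K) ∈ V := by
  have hfn : f ^ n ∈ K := by
    have := ‹K.Normal›.conj_mem _ h g⁻¹
    simpa [mul_assoc] using this
  obtain ⟨d, rfl⟩ : orderOf (f : F ⧸ K) ∣ n := by
    apply orderOf_dvd_of_pow_eq_one
    rwa [← QuotientGroup.mk_pow, QuotientGroup.eq_one_iff]
  let s : (F ⧸ K) ⧸ Subgroup.zpowers (f : F ⧸ K) := ((g : F ⧸ K) : _)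
  obtain ⟨⟨z, hz⟩, hs⟩ := QuotientGroup.mk_out_eq_mul (Subgroup.zpowers (f : F ⧸ K)) (g : F ⧸ K)
  obtain ⟨i, rfl⟩ := Subgroup.mem_zpowers_iff.1 hz
  have hk : g * f ^ i * s.out.out⁻¹ ∈ K := by
    rw [← QuotientGroup.eq_one_iff, QuotientGroup.mk_mul, QuotientGroup.mk_mul,
      QuotientGroup.mk_zpow, QuotientGroup.mk_inv, QuotientGroup.out_eq', mul_inv_eq_one]
    exact hs.symm
  have hmem := V.pow_mem (‹V.Normal›.conj_mem _ (hV s) ⟨_, hk⟩) d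
  convert hmem using 1
  apply Subtype.ext
  simp only [conjugatePower, Subgroup.coe_pow, Subgroup.coe_mul, Subgroup.coe_inv]
  generalize s.out.out = r
  rw [conj_pow, conj_pow]
  group

/-- The case of a free group, for finitely many elements instead of one. For a deep term `K` of
the series, the powers of these elements in `K` are normally generated in `K` by fewer elements
than the rank of `K`, because their orders modulo `K` are large. -/
theorem exists_hom_gammaSeries_freeGroup [Group.FG (FreeGroup α)] {a b : α} (hab : a ≠ b)
    {q : ℕ → ℕ} (hq : ∀ i, 1 < q i) (T : Finset (FreeGroup α)) :
    ∃ j, ∃ ρ : gammaSeries (FreeGroup α) q j →* FreeGroup Bool,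
      (∀ f ∈ T, ∀ (n : ℕ) (g : FreeGroup α) (h : g * f ^ n * g⁻¹ ∈ gammaSeries (FreeGroup α) q j),
        ρ ⟨_, h⟩ = 1) ∧
      ∃ h₁ h₂, exponentSum true (ρ h₁) = 1 ∧ exponentSum false (ρ h₁) ≠ 1 ∧
        exponentSum true (ρ h₂) ≠ 1 := by
  classical
  -- the generator `of a` is added so that the index of `K` is large even if `T` is trivial
  let T' := insert (of a) (T.erase 1)
  have hT' : ∀ f ∈ T', f ≠ 1 := by
    intro f hf
    rcases Finset.mem_insert.1 hf with rfl | hf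
    · exact of_ne_one a
    · exact Finset.ne_of_mem_erase hf
  obtain ⟨j₀, hj₀⟩ := ((Filter.eventually_all_finset T').2 fun f hf =>
    eventually_pow_notMem_gammaSeries hq (hT' f hf) (2 * T'.card + 4)).exists
  let K := gammaSeries (FreeGroup α) q j₀
  have hKfin : K.FiniteIndex := gammaSeries_finiteIndex (fun i => (hq i).pos) j₀
  let S := FreeGroup α ⧸ K
  have hord : ∀ f ∈ T', 2 * T'.card + 4 < orderOf (f : S) := by
    intro f hf
    by_contra! h
    refine hj₀ f hf _ (orderOf_pos _) h ?_
    rw [← QuotientGroup.eq_one_iff, QuotientGroup.mk_pow, pow_orderOf_eq_one]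
  let X := IsFreeGroup.Generators K
  let e : K ≃* FreeGroup X := IsFreeGroup.toFreeGroup K
  have : ∀ f : FreeGroup α, Fintype (S ⧸ Subgroup.zpowers (f : S)) := fun f => Fintype.ofFinite _
  let R : Finset (FreeGroup X) := T'.biUnion fun f =>
    Finset.univ.image fun s => e (conjugatePower K f s)
  have hcard : R.card + 2 ≤ K.index := by
    have h1 : R.card ≤ ∑ f ∈ T', Nat.card (S ⧸ Subgroup.zpowers (f : S)) := by
      refine Finset.card_biUnion_le.trans (Finset.sum_le_sum fun f _ => ?_)
      rw [Nat.card_eq_fintype_card]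
      exact Finset.card_image_le
    have h2 : (∑ f ∈ T', Nat.card (S ⧸ Subgroup.zpowers (f : S))) * (2 * T'.card + 4) ≤
        T'.card * K.index := by
      rw [Finset.sum_mul]
      refine Finset.sum_le_card_nsmul _ _ K.index fun f hf => ?_
      have := Subgroup.card_eq_card_quotient_mul_card_subgroup (Subgroup.zpowers (f : S))
      rw [Nat.card_zpowers] at this
      change _ ≤ Nat.card S
      rw [this]
      exact Nat.mul_le_mul_left _ (hord f hf).le
    have h3 : 2 * T'.card + 4 < K.index :=
      (hord (of a) (Finset.mem_insert_self _ _)).trans_le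
        (Nat.le_of_dvd Nat.card_pos (orderOf_dvd_natCard _))
    have h4 : R.card * (2 * T'.card + 4) ≤ T'.card * K.index :=
      (Nat.mul_le_mul_right _ h1).trans h2
    by_contra! h
    nlinarith
  obtain ⟨ι, hι⟩ := exists_injective_fin (X := X) fun _ =>
    hcard.trans (index_le_card_of_equiv K hab e)
  -- the kernel of `τ` modulo `n` contains a term of the series if `n` is a product of consecutive
  -- terms of `q`
  obtain ⟨τ, n₀, hn₀⟩ := exists_hom_of_card_add_two_le R hι
  let n := ∏ k ∈ Finset.range n₀, q (j₀ + k)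
  have hn : n₀ ≤ n := by
    refine Nat.lt_two_pow_self.le.trans ?_
    have := Finset.pow_card_le_prod (Finset.range n₀) (fun k => q (j₀ + k)) 2 fun k _ => hq _
    simpa using this
  obtain ⟨ρ, hρ, h₁, h₂, h₁t, h₁f, h₂t⟩ := hn₀ n hn
  have hle : gammaSeries (FreeGroup α) q (j₀ + n₀) ≤ K :=
    gammaSeries_antitone q (Nat.le_add_right _ _)
  let i₁ : gammaSeries (FreeGroup α) q (j₀ + n₀) →* FreeGroup X :=
    e.toMonoidHom.comp (Subgroup.inclusion hle)
  let i₂ := i₁.codRestrict ((Subgroup.zpowers (Multiplicative.ofAdd (n : ℤ))).comap τ) (by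
    rintro ⟨x, hx⟩
    obtain ⟨y, hy, rfl⟩ := gammaSeries_add_le_map_comap q j₀ n₀ (τ.comp e.toMonoidHom) hx
    exact hy)
  have hpow : ∀ h, ∃ y, ∃ N : ℕ, N ≠ 0 ∧ ρ (i₂ y) = ρ h ^ N := by
    intro h
    have hfin : (gammaSeries (FreeGroup α) q (j₀ + n₀)).FiniteIndex :=
      gammaSeries_finiteIndex (fun i => (hq i).pos) _
    refine ⟨⟨_, Subgroup.pow_index_mem (gammaSeries (FreeGroup α) q (j₀ + n₀))
      (e.symm h.1 : FreeGroup α)⟩, _, hfin.index_ne_zero, ?_⟩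
    rw [← map_pow]
    congr 1
    apply Subtype.ext
    have : ∀ N : ℕ, e (e.symm h.1 ^ N) = h.1 ^ N := fun N => by
      rw [map_pow, e.apply_symm_apply]
    exact this _
  refine ⟨j₀ + n₀, ρ.comp i₂, fun f hf m g h => ?_, ?_⟩
  · rcases eq_or_ne f 1 with rfl | hf1
    · have : (⟨g * 1 ^ m * g⁻¹, h⟩ : gammaSeries (FreeGroup α) q (j₀ + n₀)) = 1 :=
        Subtype.ext (by simp)
      rw [this, _root_.map_one]
    · refine hρ _ ?_
      have := conj_pow_mem_of_conjugatePower_mem (K := K) (f := f)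
        (V := (Subgroup.normalClosure (R : Set (FreeGroup X))).comap e.toMonoidHom) (fun s => ?_)
        (hle h)
      · exact this
      · refine Subgroup.mem_comap.2 (Subgroup.subset_normalClosure ?_)
        exact Finset.mem_biUnion.2 ⟨f, Finset.mem_insert_of_mem (Finset.mem_erase.2 ⟨hf1, hf⟩),
          Finset.mem_image_of_mem _ (Finset.mem_univ s)⟩
  · obtain ⟨y₁, N₁, hN₁, hy₁⟩ := hpow h₁
    obtain ⟨y₂, N₂, hN₂, hy₂⟩ := hpow h₂
    refine ⟨y₁, y₂, ?_, ?_, ?_⟩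
    · rw [MonoidHom.comp_apply, hy₁, map_pow, h₁t, one_pow]
    · rw [MonoidHom.comp_apply, hy₁, map_pow]
      exact mt (pow_eq_one_iff_left hN₁).1 h₁f
    · rw [MonoidHom.comp_apply, hy₂, map_pow]
      exact mt (pow_eq_one_iff_left hN₂).1 h₂t

end FreeSeries

theorem mainTheorem4 (p : ℕ → ℕ) (hp : ∀ i, (p i).Prime)
    (G : Type*) [Group G] (hG : Group.FG G) (r : ℕ)
    (hr : MapsOntoNonabelianFree (gammaSeries G p r))
    (g : G) (hg : g ∈ gammaSeries G p r) :
    ∃ m : ℕ, r ≤ m ∧ ∀ n : ℕ, g ^ n ∈ gammaSeries G p m →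
      MapsOntoNonabelianFree
        (gammaSeries G p m ⧸
          (Subgroup.normalClosure {g ^ n}).subgroupOf (gammaSeries G p m)) := by
  classical
  obtain ⟨α, ⟨x, y, hxy⟩, φ, hφ⟩ := hr
  let N := gammaSeries G p r
  have hNfin : N.FiniteIndex := gammaSeries_finiteIndex (fun i => (hp i).pos) r
  have hNfg : Group.FG N := Subgroup.fg_of_index_ne_zero _
  have hFfg : Group.FG (FreeGroup α) := Group.fg_of_surjective hφ
  obtain ⟨a, b, hab⟩ : ∃ a b : α, a ≠ b := by
    by_contra! h
    have : Subsingleton α := ⟨h⟩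
    obtain ⟨c, hc⟩ := FreeGroup.exists_forall_mem_zpowers α
    obtain ⟨k, rfl⟩ := Subgroup.mem_zpowers_iff.1 (hc x)
    obtain ⟨l, rfl⟩ := Subgroup.mem_zpowers_iff.1 (hc y)
    exact hxy (by rw [← zpow_add, ← zpow_add, add_comm])
  have : Fintype (G ⧸ N) := Fintype.ofFinite _
  -- `φ` is not defined on `G`, so each of the finitely many conjugates of `g` up to conjugation in
  -- `N` contributes a relator
  let conj : G ⧸ N → N := fun t =>
    ⟨t.out * g * t.out⁻¹, (gammaSeries_normal p r).conj_mem g hg _⟩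
  obtain ⟨j, ρ, hρ, h₁, h₂, h₁t, h₁f, h₂t⟩ := exists_hom_gammaSeries_freeGroup hab
    (q := fun i => p (r + i)) (fun i => (hp _).one_lt) (Finset.univ.image (φ ∘ conj))
  have hle : gammaSeries G p (r + j) ≤ N := gammaSeries_antitone p (Nat.le_add_right _ _)
  have hmap := map_gammaSeries_of_surjective φ hφ (fun i => p (r + i)) j
  let θ := (φ.comp (Subgroup.inclusion hle)).codRestrict
    (gammaSeries (FreeGroup α) (fun i => p (r + i)) j) (by
      rintro ⟨z, hz⟩
      rw [gammaSeries_add] at hz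
      obtain ⟨w, hw, rfl⟩ := hz
      rw [← hmap]
      exact Subgroup.mem_map_of_mem φ hw)
  have hθ : Function.Surjective θ := by
    rintro ⟨z, hz⟩
    rw [← hmap] at hz
    obtain ⟨w, hw, rfl⟩ := hz
    refine ⟨⟨w, ?_⟩, rfl⟩
    rw [gammaSeries_add]
    exact Subgroup.mem_map_of_mem _ hw
  refine ⟨r + j, Nat.le_add_right _ _, fun n hn => ?_⟩
  have hker : Subgroup.normalClosure {g ^ n} ≤
      (ρ.comp θ).ker.map (gammaSeries G p (r + j)).subtype := by
    refine (Subgroup.closure_le _).2 fun z hz => ?_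
    obtain ⟨_, rfl, hc⟩ := Group.mem_conjugatesOfSet_iff.1 hz
    obtain ⟨c, rfl⟩ := isConj_iff.1 hc
    have hmem : c * g ^ n * c⁻¹ ∈ gammaSeries G p (r + j) :=
      (gammaSeries_normal p (r + j)).conj_mem _ hn c
    refine ⟨⟨_, hmem⟩, MonoidHom.mem_ker.2 ?_, rfl⟩
    let t : G ⧸ N := c
    have hd : c * t.out⁻¹ ∈ N := by
      rw [← QuotientGroup.eq_one_iff, QuotientGroup.mk_mul, QuotientGroup.mk_inv,
        QuotientGroup.out_eq', mul_inv_cancel]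
    have heq : φ ⟨c * g ^ n * c⁻¹, hle hmem⟩ =
        φ ⟨_, hd⟩ * (φ (conj t)) ^ n * (φ ⟨_, hd⟩)⁻¹ := by
      rw [← map_pow, ← map_inv, ← map_mul, ← map_mul]
      congr 1
      apply Subtype.ext
      simp only [conj, Subgroup.coe_mul, Subgroup.coe_pow, Subgroup.coe_inv, conj_pow]
      group
    have hθz : (θ ⟨_, hmem⟩ : FreeGroup α) = _ := heq
    have hmem' := (θ ⟨_, hmem⟩).2
    rw [hθz] at hmem'
    have := hρ (φ (conj t)) (Finset.mem_image_of_mem _ (Finset.mem_univ t)) n (φ ⟨_, hd⟩) hmem'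
    rw [MonoidHom.comp_apply, ← this]
    exact congrArg ρ (Subtype.ext hθz)
  let f := QuotientGroup.lift
    ((Subgroup.normalClosure {g ^ n}).subgroupOf (gammaSeries G p (r + j))) (ρ.comp θ) (by
      intro z hz
      obtain ⟨w, hw, hwz⟩ := hker (Subgroup.mem_subgroupOf.1 hz)
      rw [← Subtype.ext hwz]
      exact hw)
  obtain ⟨y₁, rfl⟩ := hθ h₁
  obtain ⟨y₂, rfl⟩ := hθ h₂
  exact mapsOntoNonabelianFree_of_exponentSum f (h₁ := (y₁ : _ ⧸ _)) (h₂ := (y₂ : _ ⧸ _))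
    h₁t h₁f h₂t
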